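/- **Theorem (cut-free completeness of $\mathbf{LK}_H$).** Fix a first-order signature $\Sigma$ (countably many function and predicate symbols with arities, no equality) with at least one constant symbol, a countably infinite set $V$ of variable symbols, and a countable nonempty set $I$ of indices. For every closed prenex formula $A$ over $\Sigma$ that is valid in classical first-order logic (true in all nonempty structures) there is an expansion tree $t$ of type $A$ such that $t:A$ has a cut-free strict $\mathbf{LK}_H$ derivation. Here the following notions are used. *Formulas.* Quantifier-free formulas $P$ are built from positive and negative atoms $p(M_1,\dots,M_n)$, $\bar p(M_1,\dots,M_n)$ by $\land$ and $\lor$. Prenex formulas are given by $A ::= P \mid \exists x.A \mid \forall x.A$ and are taken up to renaming of bound variables. $\bar A$ denotes the De Morgan dual, $A[x:=M]$ capture-avoiding substitution. *Expansion trees.* $t ::= S \mid \alpha[a].t \mid (w_1+\dots+w_n)$ and witnessing terms $w ::= \varepsilon[M].t$, where $S\subseteq I$ is finite and nonempty, $a\in V$, $M$ is a first-order term, $n\ge 1$, and $+$ is associative and commutative (a formal sum is an element of the free commutative semigroup over the witnessing terms). Typing: $S:P$ for $P$ quantifier-free; $\alpha[a].t:\forall x.A$ if $t:A[x:=a]$;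 $(\varepsilon[M_1].t_1+\dots+\varepsilon[M_n].t_n):\exists x.A$ if $t_k:A[x:=M_k]$ for all $k$. *The calculus.* $\mathbf{LK}_H$ derives finite multisets $F$ whose members are typed expansion trees $t:A$ and cuts $t\bowtie s:A\bowtie\bar A$, by the rules - (tautology, with index $i\in I$) $\{i\}:P_1,\dots,\{i\}:P_n$ is an axiom whenever the $P_j$ are quantifier-free and $\vDash P_1\lor\dots\lor P_n$; - ($\forall R$, with eigenvariable $a$) from $F,\ t:A[x:=a]$ infer $F,\ \alpha[a].t:\forall x.A$; - ($\exists R$) from $F,\ t:A[x:=M]$ infer $F,\ (\varepsilon[M].t):\exists x.A$; - ($C_\exists$) from $F,\ t:\exists x.A,\ s:\exists x.A$ infer $F,\ t+s:\exists x.A$; - ($C_P$) from $F,\ S:P,\ T:P$ with $P$ quantifier-free infer $F,\ S\cup T:P$; - (Cut) from $F,\ t:A$ and $G,\ s:\bar A$ infer $F,\ G,\ t\bowtie s:A\bowtie\bar A$. A derivation is *cut-free* if it contains no instance of Cut. The type of a multiset $F$ is the multiset of the types of its non-cut members. A derivation is *strict* if (i) distinct instances of the tautology rule have distinct indices; (ii)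 distinct instances of $\forall R$ have distinct eigenvariables; and (iii) the eigenvariable of an instance of $\forall R$ is not free in the type of any sequent of the derivation outside the subderivation ending in the premise of that instance. -/

import Mathlib

/-!
Prenex first-order logic, expansion trees and the annotated sequent calculus `LK_H`.

A signature is a first-order language `L` together with a type `V` of variable symbols.  First-order
terms are Mathlib's `L.Term V`.  Prenex formulas are taken up to renaming of bound variables: free
variables are named by `V`, bound variables are de Bruijn levels, as in Mathlib's `BoundedFormula`.
-/

universe u v w x

namespace LKH

/-! ### Formulas -/

/-- Quantifier-free formulas in negation normal form, with variables in `α`.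
`lit true p M` is the atom `p(M₁,…,Mₙ)`, `lit false p M` is the dual atom. -/
inductive QFF (L : FirstOrder.Language.{u, v}) (α : Type w) : Type (max u v w)
  | lit (pos : Bool) {n : ℕ} (p : L.Relations n) (M : Fin n → L.Term α) : QFF L α
  | and (P Q : QFF L α) : QFF L α
  | or (P Q : QFF L α) : QFF L α

namespace QFF

variable {L : FirstOrder.Language.{u, v}} {α : Type w} {β : Type x}

/-- De Morgan dual. -/
def dual : QFF L α → QFF L α
  | lit pos p M => lit (!pos) p M
  | and P Q => or P.dual Q.dual
  | or P Q => and P.dual Q.dual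

open Classical in
/-- The variables occurring in a quantifier-free formula. -/
def vars : QFF L α → Set α
  | lit _ _ M => {a | ∃ i, a ∈ (M i).varFinset}
  | and P Q => P.vars ∪ Q.vars
  | or P Q => P.vars ∪ Q.vars

/-- Simultaneous substitution of terms for variables. -/
def subst (σ : α → L.Term β) : QFF L α → QFF L β
  | lit pos p M => lit pos p fun i => (M i).subst σ
  | and P Q => and (P.subst σ) (Q.subst σ)
  | or P Q => or (P.subst σ) (Q.subst σ)

/-- Truth in a structure under an assignment. -/
def Realize {M : Type*} [L.Structure M] (s : α → M) : QFF L α → Prop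
  | lit true p N => FirstOrder.Language.Structure.RelMap p fun i => (N i).realize s
  | lit false p N => ¬ FirstOrder.Language.Structure.RelMap p fun i => (N i).realize s
  | and P Q => P.Realize s ∧ Q.Realize s
  | or P Q => P.Realize s ∨ Q.Realize s

end QFF

/-- Prenex formulas with named free variables in `V`, in the scope of `n` further quantifiers whose
variables are `0, …, n - 1` (outermost first).  A prenex formula proper has `n = 0`; the body `A` of
`∀x.A` or `∃x.A` has `n = 1`, with `x` the variable `0`. -/
inductive Prenex (L : FirstOrder.Language.{u, v}) (V : Type w) : ℕ → Type (max u v w)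
  | qff {n : ℕ} (P : QFF L (V ⊕ Fin n)) : Prenex L V n
  | all {n : ℕ} (A : Prenex L V (n + 1)) : Prenex L V n
  | ex {n : ℕ} (A : Prenex L V (n + 1)) : Prenex L V n

namespace Prenex

variable {L : FirstOrder.Language.{u, v}} {V : Type w}

/-- De Morgan dual. -/
def dual : {n : ℕ} → Prenex L V n → Prenex L V n
  | _, qff P => qff P.dual
  | _, all A => ex A.dual
  | _, ex A => all A.dual

/-- The free variables. -/
def free : {n : ℕ} → Prenex L V n → Set V
  | _, qff P => {a | Sum.inl a ∈ P.vars}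
  | _, all A => A.free
  | _, ex A => A.free

/-- The substitution replacing the outermost bound variable `0` by `M`. -/
def instVar (M : L.Term V) (n : ℕ) : V ⊕ Fin (n + 1) → L.Term (V ⊕ Fin n) :=
  Sum.elim (fun a => .var (Sum.inl a))
    (Fin.cases (M.relabel Sum.inl) fun i => .var (Sum.inr i))

/-- `A.inst M` is `A[x := M]`, where `x` is the outermost bound variable of the body `A`. -/
def inst (M : L.Term V) : {n : ℕ} → Prenex L V (n + 1) → Prenex L V n
  | n, qff P => qff (P.subst (instVar M n))
  | _, all A => all (A.inst M)
  | _, ex A => ex (A.inst M)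

/-- Truth in a structure, with `s` assigning values to the free variables and `e` to the variables
bound by the quantifiers outside. -/
def Realize {M : Type*} [L.Structure M] (s : V → M) : {n : ℕ} → (Fin n → M) → Prenex L V n → Prop
  | _, e, qff P => P.Realize (Sum.elim s e)
  | _, e, all A => ∀ m : M, A.Realize s (Fin.snoc e m)
  | _, e, ex A => ∃ m : M, A.Realize s (Fin.snoc e m)

/-- Validity in classical first-order logic: truth in all nonempty structures under all
assignments. -/
def Valid (A : Prenex L V 0) : Prop :=
  ∀ (M : Type (max u w)) [L.Structure M] [Nonempty M] (s : V → M), A.Realize s Fin.elim0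

end Prenex

/-- `⊨ P₁ ∨ … ∨ Pₙ`: in every nonempty structure, every assignment satisfies some `Pⱼ`. -/
def ValidDisj {L : FirstOrder.Language.{u, v}} {V : Type w} (Ps : Multiset (QFF L (V ⊕ Fin 0))) :
    Prop :=
  ∀ (M : Type (max u w)) [L.Structure M] [Nonempty M] (s : V → M),
    ∃ P ∈ Ps, P.Realize (Sum.elim s Fin.elim0)

/-! ### Expansion trees -/

/-- The two kinds of syntax: expansion trees, and formal sums of witnessing terms. -/
inductive Kind
  | tree
  | wits

/-- Expansion trees and sums of witnessing terms, before sums are identified up to associativity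
and commutativity of `+`. -/
inductive RawTerm (L : FirstOrder.Language.{u, v}) (V : Type w) (I : Type x) :
    Kind → Type (max u w x)
  /-- a nonempty finite set of indices -/
  | leaf (S : Finset I) (hS : S.Nonempty) : RawTerm L V I .tree
  /-- `α[a].t` -/
  | alpha (a : V) (t : RawTerm L V I .tree) : RawTerm L V I .tree
  /-- `(w₁ + ⋯ + wₙ)` -/
  | sum (W : RawTerm L V I .wits) : RawTerm L V I .tree
  /-- the one-element sum `ε[M].t` -/
  | eps (M : L.Term V) (t : RawTerm L V I .tree) : RawTerm L V I .wits
  /-- `W + W'` -/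
  | add (W W' : RawTerm L V I .wits) : RawTerm L V I .wits

namespace RawTerm

variable {L : FirstOrder.Language.{u, v}} {V : Type w} {I : Type x}

/-- The congruence generated by associativity and commutativity of `+`. -/
inductive Equiv : {k : Kind} → RawTerm L V I k → RawTerm L V I k → Prop
  | refl {k : Kind} (t : RawTerm L V I k) : Equiv t t
  | symm {k : Kind} {t s : RawTerm L V I k} : Equiv t s → Equiv s t
  | trans {k : Kind} {t s r : RawTerm L V I k} : Equiv t s → Equiv s r → Equiv t r
  | alpha (a : V) {t s : RawTerm L V I .tree} : Equiv t s → Equiv (.alpha a t) (.alpha a s)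
  | sum {W X : RawTerm L V I .wits} : Equiv W X → Equiv (.sum W) (.sum X)
  | eps (M : L.Term V) {t s : RawTerm L V I .tree} : Equiv t s → Equiv (.eps M t) (.eps M s)
  | add {W X W' X' : RawTerm L V I .wits} :
      Equiv W X → Equiv W' X' → Equiv (.add W W') (.add X X')
  | add_comm (W X : RawTerm L V I .wits) : Equiv (.add W X) (.add X W)
  | add_assoc (W X Y : RawTerm L V I .wits) :
      Equiv (.add (.add W X) Y) (.add W (.add X Y))

/-- The setoid of the congruence. -/
def setoid (L : FirstOrder.Language.{u, v}) (V : Type w) (I : Type x) (k : Kind) :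
    Setoid (RawTerm L V I k) :=
  ⟨Equiv, ⟨.refl, .symm, .trans⟩⟩

end RawTerm

/-- Expansion trees. -/
def ExpTree (L : FirstOrder.Language.{u, v}) (V : Type w) (I : Type x) : Type (max u w x) :=
  Quotient (RawTerm.setoid L V I .tree)

/-- Nonempty formal sums of witnessing terms (the free commutative semigroup over them). -/
def WitSum (L : FirstOrder.Language.{u, v}) (V : Type w) (I : Type x) : Type (max u w x) :=
  Quotient (RawTerm.setoid L V I .wits)

section

variable {L : FirstOrder.Language.{u, v}} {V : Type w} {I : Type x}

/-- `ε[M].t`, as a one-element sum. -/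
def WitSum.eps (M : L.Term V) : ExpTree L V I → WitSum L V I :=
  Quotient.map (RawTerm.eps M) fun _ _ h => .eps M h

/-- `W + W'`. -/
def WitSum.add : WitSum L V I → WitSum L V I → WitSum L V I :=
  Quotient.map₂ RawTerm.add fun _ _ h _ _ h' => .add h h'

/-- A nonempty finite set of indices, as an expansion tree. -/
def ExpTree.leaf (S : Finset I) (hS : S.Nonempty) : ExpTree L V I :=
  Quotient.mk (RawTerm.setoid L V I .tree) (.leaf S hS)

/-- `α[a].t`. -/
def ExpTree.alpha (a : V) : ExpTree L V I → ExpTree L V I :=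
  Quotient.map (RawTerm.alpha a) fun _ _ h => .alpha a h

/-- `(w₁ + ⋯ + wₙ)`. -/
def ExpTree.sum : WitSum L V I → ExpTree L V I :=
  Quotient.map RawTerm.sum fun _ _ h => .sum h

mutual

/-- Typing of expansion trees: `t : A`. -/
inductive ExpTree.HasType : ExpTree L V I → Prenex L V 0 → Prop
  | leaf (S : Finset I) (hS : S.Nonempty) (P : QFF L (V ⊕ Fin 0)) :
      ExpTree.HasType (ExpTree.leaf S hS) (.qff P)
  | alpha (a : V) (t : ExpTree L V I) (A : Prenex L V 1) :
      ExpTree.HasType t (A.inst (.var a)) → ExpTree.HasType (ExpTree.alpha a t) (.all A)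
  | sum (W : WitSum L V I) (A : Prenex L V 1) :
      WitSum.HasType W A → ExpTree.HasType (ExpTree.sum W) (.ex A)

/-- `W.HasType A` means that every summand of `W` has the witness type `⟨∃x.A⟩`. -/
inductive WitSum.HasType : WitSum L V I → Prenex L V 1 → Prop
  | eps (M : L.Term V) (t : ExpTree L V I) (A : Prenex L V 1) :
      ExpTree.HasType t (A.inst M) → WitSum.HasType (WitSum.eps M t) A
  | add (W W' : WitSum L V I) (A : Prenex L V 1) :
      WitSum.HasType W A → WitSum.HasType W' A → WitSum.HasType (WitSum.add W W') A

end

end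

/-! ### The calculus -/

/-- The roots of the forests on which the calculus operates: an expansion tree with a prenex formula
as its type, or a cut `t ⋈ s : A ⋈ Ā` (recorded by `t`, `s` and `A`). -/
inductive TypedTerm (L : FirstOrder.Language.{u, v}) (V : Type w) (I : Type x) :
    Type (max u v w x)
  | tree (t : ExpTree L V I) (A : Prenex L V 0) : TypedTerm L V I
  | cut (t s : ExpTree L V I) (A : Prenex L V 0) : TypedTerm L V I

/-- The variables free in the type of a forest; the type consists of the types of the non-cut
roots. -/
def freeType {L : FirstOrder.Language.{u, v}} {V : Type w} {I : Type x}
    (F : Multiset (TypedTerm L V I)) : Set V :=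
  {a | ∃ t A, TypedTerm.tree t A ∈ F ∧ a ∈ A.free}

open Classical in
/-- `LK_H` derivations (not necessarily strict) of a forest. -/
inductive Deriv (L : FirstOrder.Language.{u, v}) (V : Type w) (I : Type x) :
    Multiset (TypedTerm L V I) → Type (max u v w x)
  /-- tautology rule with index `i`: from `⊨ ⋁ Pⱼ` infer `{i} : P₁, …, {i} : Pₙ` -/
  | taut (i : I) (Ps : Multiset (QFF L (V ⊕ Fin 0))) (h : ValidDisj Ps) :
      Deriv L V I
        (Ps.map fun P => .tree (ExpTree.leaf {i} (Finset.singleton_nonempty i)) (.qff P))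
  /-- `∀R` with eigenvariable `a` -/
  | allR (F : Multiset (TypedTerm L V I)) (a : V) (t : ExpTree L V I) (A : Prenex L V 1) :
      Deriv L V I (.tree t (A.inst (.var a)) ::ₘ F) →
      Deriv L V I (.tree (ExpTree.alpha a t) (.all A) ::ₘ F)
  /-- `∃R` with witness `M` -/
  | exR (F : Multiset (TypedTerm L V I)) (M : L.Term V) (t : ExpTree L V I) (A : Prenex L V 1) :
      Deriv L V I (.tree t (A.inst M) ::ₘ F) →
      Deriv L V I (.tree (ExpTree.sum (WitSum.eps M t)) (.ex A) ::ₘ F)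
  /-- contraction on an existential formula -/
  | contrEx (F : Multiset (TypedTerm L V I)) (W W' : WitSum L V I) (A : Prenex L V 1) :
      Deriv L V I (.tree (ExpTree.sum W) (.ex A) ::ₘ .tree (ExpTree.sum W') (.ex A) ::ₘ F) →
      Deriv L V I (.tree (ExpTree.sum (WitSum.add W W')) (.ex A) ::ₘ F)
  /-- contraction on a quantifier-free formula -/
  | contrQF (F : Multiset (TypedTerm L V I)) (S T : Finset I) (hS : S.Nonempty) (hT : T.Nonempty)
      (P : QFF L (V ⊕ Fin 0)) :
      Deriv L V I
        (.tree (ExpTree.leaf S hS) (.qff P) ::ₘ .tree (ExpTree.leaf T hT) (.qff P) ::ₘ F) →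
      Deriv L V I (.tree (ExpTree.leaf (S ∪ T) (hS.mono Finset.subset_union_left)) (.qff P) ::ₘ F)
  /-- cut -/
  | cut (F G : Multiset (TypedTerm L V I)) (t s : ExpTree L V I) (A : Prenex L V 0) :
      Deriv L V I (.tree t A ::ₘ F) → Deriv L V I (.tree s A.dual ::ₘ G) →
      Deriv L V I (.cut t s A ::ₘ (F + G))

namespace Deriv

variable {L : FirstOrder.Language.{u, v}} {V : Type w} {I : Type x}

/-- No instance of the cut rule is used. -/
def CutFree : {F : Multiset (TypedTerm L V I)} → Deriv L V I F → Prop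
  | _, taut _ _ _ => True
  | _, allR _ _ _ _ d => d.CutFree
  | _, exR _ _ _ _ d => d.CutFree
  | _, contrEx _ _ _ _ d => d.CutFree
  | _, contrQF _ _ _ _ _ _ d => d.CutFree
  | _, cut _ _ _ _ _ _ _ => False

/-- The indices of the instances of the tautology rule. -/
def indices : {F : Multiset (TypedTerm L V I)} → Deriv L V I F → List I
  | _, taut i _ _ => [i]
  | _, allR _ _ _ _ d => d.indices
  | _, exR _ _ _ _ d => d.indices
  | _, contrEx _ _ _ _ d => d.indices
  | _, contrQF _ _ _ _ _ _ d => d.indices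
  | _, cut _ _ _ _ _ d e => d.indices ++ e.indices

/-- The eigenvariables of the instances of `∀R`. -/
def eigenvars : {F : Multiset (TypedTerm L V I)} → Deriv L V I F → List V
  | _, taut _ _ _ => []
  | _, allR _ a _ _ d => a :: d.eigenvars
  | _, exR _ _ _ _ d => d.eigenvars
  | _, contrEx _ _ _ _ d => d.eigenvars
  | _, contrQF _ _ _ _ _ _ d => d.eigenvars
  | _, cut _ _ _ _ _ d e => d.eigenvars ++ e.eigenvars

/-- The variables free in the type of some sequent of the derivation. -/
def occurring {F : Multiset (TypedTerm L V I)} (Φ : Deriv L V I F) : Set V :=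
  freeType F ∪
    match Φ with
    | taut _ _ _ => ∅
    | allR _ _ _ _ d => d.occurring
    | exR _ _ _ _ d => d.occurring
    | contrEx _ _ _ _ d => d.occurring
    | contrQF _ _ _ _ _ _ d => d.occurring
    | cut _ _ _ _ _ d e => d.occurring ∪ e.occurring

/-- Auxiliary condition on a subderivation `Φ` of a derivation `Ψ`, where `X` is the set of the
variables free in the type of some sequent of `Ψ` outside `Φ`: no eigenvariable of an instance of
`∀R` in `Φ` is free in the type of a sequent of `Ψ` outside the subderivation ending in the premise
of that instance. -/
def EigenLocal (X : Set V) {F : Multiset (TypedTerm L V I)} (Φ : Deriv L V I F) : Prop :=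
  match Φ with
  | taut _ _ _ => True
  | allR _ a _ _ d => a ∉ X ∪ freeType F ∧ d.EigenLocal (X ∪ freeType F)
  | exR _ _ _ _ d => d.EigenLocal (X ∪ freeType F)
  | contrEx _ _ _ _ d => d.EigenLocal (X ∪ freeType F)
  | contrQF _ _ _ _ _ _ d => d.EigenLocal (X ∪ freeType F)
  | cut _ _ _ _ _ d e =>
      d.EigenLocal (X ∪ freeType F ∪ e.occurring) ∧ e.EigenLocal (X ∪ freeType F ∪ d.occurring)

/-- Strict derivations. -/
structure Strict {F : Multiset (TypedTerm L V I)} (d : Deriv L V I F) : Prop where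
  /-- distinct instances of the tautology rule have distinct indices -/
  nodup_indices : d.indices.Nodup
  /-- distinct instances of `∀R` have distinct eigenvariables -/
  nodup_eigenvars : d.eigenvars.Nodup
  /-- an eigenvariable is not free in the type of a sequent outside the subderivation above its
  `∀R` -/
  eigenLocal : d.EigenLocal ∅

end Deriv

end LKH

namespace LKH

open FirstOrder Language Filter

variable {L : FirstOrder.Language.{u, v}} {V : Type w} {I : Type x}

/-! ### Substitution and semantics -/

-- The proof is a Henkin–Schütte argument by contraposition: an unprovable formula has a
-- countermodel on the terms. Reading the rules upwards, an unprovable multiset stays unprovable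
-- when universal formulas are replaced by instances at fresh variables (`exists_handled`), and when
-- an existential formula is kept by contraction and an instance at any chosen term is added
-- (`exists_instance`). A fair iteration gives an increasing sequence of unprovable multisets that
-- instantiates every existential formula by every term (`exists_saturated`). At each stage some
-- valuation of atoms falsifies all quantifier-free members; otherwise their disjunction would be a
-- tautology, and the other members could be weakened in (`of_valid`). The valuations of different
-- stages need not cohere, so their limit along a nonprincipal ultrafilter is taken; it falsifies
-- the quantifier-free members of all stages. Induction along instances then refutes every handled
-- formula in the resulting term model. Strictness costs little: cut is the only rule with two
-- premises, so a cut-free derivation has one axiom and needs one index. Eigenvariables are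
-- controlled by carrying a finite forbidden set upwards and choosing fresh variables.

theorem QFF.vars_finite {α : Type*} (P : QFF L α) : P.vars.Finite := by
  classical
  induction P with
  | lit pos p M =>
    refine (Set.finite_iUnion fun i => ((M i).varFinset).finite_toSet).subset ?_
    rintro a ⟨i, hi⟩
    refine Set.mem_iUnion.2 ⟨i, Finset.mem_coe.2 ?_⟩
    convert hi
  | and P Q hP hQ => exact hP.union hQ
  | or P Q hP hQ => exact hP.union hQ

theorem QFF.realize_subst {α β M : Type*} [L.Structure M] (σ : α → L.Term β) (s : β → M)
    (P : QFF L α) : (P.subst σ).Realize s ↔ P.Realize fun a => (σ a).realize s := by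
  induction P with
  | lit pos p N => cases pos <;> simp [QFF.subst, QFF.Realize, Term.realize_subst]
  | and P Q hP hQ => simp [QFF.subst, QFF.Realize, hP, hQ]
  | or P Q hP hQ => simp [QFF.subst, QFF.Realize, hP, hQ]

namespace Prenex

theorem free_finite {n : ℕ} (A : Prenex L V n) : A.free.Finite := by
  induction A with
  | qff P => exact P.vars_finite.preimage Sum.inl_injective.injOn
  | all A h => exact h
  | ex A h => exact h

theorem realize_inst {M : Type*} [L.Structure M] (s : V → M) (N : L.Term V) :
    ∀ {n : ℕ} (e : Fin n → M) (A : Prenex L V (n + 1)),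
      (A.inst N).Realize s e ↔ A.Realize s (Fin.cons (N.realize s) e)
  | n, e, qff P => by
    simp only [inst, Realize, QFF.realize_subst]
    refine iff_of_eq (congrArg (P.Realize ·) ?_)
    funext a
    rcases a with a | i
    · rfl
    · refine Fin.cases ?_ (fun j => ?_) i
      · simp [instVar, Term.realize_relabel, Sum.elim_comp_inl]
      · simp [instVar]
  | _, e, all A => by
    simp only [inst, Realize, ← Fin.cons_snoc_eq_snoc_cons]
    exact forall_congr' fun m => realize_inst s N (Fin.snoc e m) A
  | _, e, ex A => by
    simp only [inst, Realize, ← Fin.cons_snoc_eq_snoc_cons]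
    exact exists_congr fun m => realize_inst s N (Fin.snoc e m) A

theorem realize_inst_zero {M : Type*} [L.Structure M] (s : V → M) (N : L.Term V)
    (A : Prenex L V 1) :
    (A.inst N).Realize s Fin.elim0 ↔ A.Realize s (Fin.snoc Fin.elim0 (N.realize s)) := by
  rw [realize_inst]
  refine iff_of_eq (congrArg (A.Realize s ·) ?_)
  funext i
  obtain rfl : i = 0 := Fin.eq_zero i
  rfl

/-- The number of quantifiers. -/
def depth : {n : ℕ} → Prenex L V n → ℕ
  | _, qff _ => 0
  | _, all A => A.depth + 1
  | _, ex A => A.depth + 1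

theorem depth_inst (N : L.Term V) :
    ∀ {n : ℕ} (A : Prenex L V (n + 1)), (A.inst N).depth = A.depth
  | _, qff P => by simp only [inst, depth]
  | _, all A => by simp only [inst, depth, depth_inst N A]
  | _, ex A => by simp only [inst, depth, depth_inst N A]

/-- Induction on prenex formulas along their instances. -/
theorem inst_induction {motive : Prenex L V 0 → Prop} (qff : ∀ P, motive (qff P))
    (all : ∀ A : Prenex L V 1, (∀ N, motive (A.inst N)) → motive (all A))
    (ex : ∀ A : Prenex L V 1, (∀ N, motive (A.inst N)) → motive (ex A)) (A : Prenex L V 0) :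
    motive A := by
  -- Instances are not subterms, but instantiation preserves the number of quantifiers.
  induction hd : A.depth using Nat.strong_induction_on generalizing A with
  | _ d ih =>
    subst hd
    cases A with
    | qff P => exact qff P
    | all A => exact all A fun N => ih _ (by simp [depth, depth_inst]) _ rfl
    | ex A => exact ex A fun N => ih _ (by simp [depth, depth_inst]) _ rfl

end Prenex

/-! ### Provability -/

/-- The variables free in a multiset of formulas. -/
def freeOf (Γ : Multiset (Prenex L V 0)) : Set V := {a | ∃ A ∈ Γ, a ∈ A.free}

theorem freeOf_finite (Γ : Multiset (Prenex L V 0)) : (freeOf Γ).Finite := by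
  classical
  refine (Γ.toFinset.finite_toSet.biUnion fun A _ => A.free_finite).subset ?_
  rintro a ⟨A, hA, ha⟩
  exact Set.mem_biUnion (by simpa using hA) ha

/-- The root is an expansion tree typed by the given formula. -/
def IsTyped (T : TypedTerm L V I) (A : Prenex L V 0) : Prop :=
  ∃ t : ExpTree L V I, t.HasType A ∧ T = .tree t A

theorem freeType_eq_freeOf {F : Multiset (TypedTerm L V I)} {Γ : Multiset (Prenex L V 0)}
    (h : Multiset.Rel IsTyped F Γ) : freeType F = freeOf Γ := by
  induction h with
  | zero => simp [freeType, freeOf]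
  | cons hab h ih =>
    obtain ⟨t, -, rfl⟩ := hab
    ext a
    have := Set.ext_iff.1 ih a
    simp only [freeType, freeOf, Set.mem_ofPred_eq, Multiset.mem_cons, TypedTerm.tree.injEq] at *
    grind

/-- Eigenvariables need only lie outside a set that grows with the parameter. This discards the
variable that `Prov.allR` adds to the forbidden set. -/
theorem Deriv.EigenLocal.anti {F : Multiset (TypedTerm L V I)} {d : Deriv L V I F} {X Y : Set V}
    (h : d.EigenLocal Y) (hXY : X ⊆ Y) : d.EigenLocal X := by
  induction d generalizing X Y with
  | taut => trivial
  | allR F a t A d ih =>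
    exact ⟨fun ha => h.1 (Set.union_subset_union_left _ hXY ha),
      ih h.2 (Set.union_subset_union_left _ hXY)⟩
  | exR F M t A d ih => exact ih (Y := _) h (Set.union_subset_union_left _ hXY)
  | contrEx F W W' A d ih => exact ih (Y := _) h (Set.union_subset_union_left _ hXY)
  | contrQF F S T hS hT P d ih => exact ih (Y := _) h (Set.union_subset_union_left _ hXY)
  | cut F G t s A d e ihd ihe =>
    have := Set.union_subset_union_left (freeType (.cut t s A ::ₘ (F + G))) hXY
    exact ⟨ihd h.1 (Set.union_subset_union_left _ this),
      ihe h.2 (Set.union_subset_union_left _ this)⟩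

/-- `Γ` is the type of the end sequent of a cut-free strict derivation whose eigenvariables
avoid `X`. -/
def Prov (I : Type x) (X : Set V) (Γ : Multiset (Prenex L V 0)) : Prop :=
  ∃ F : Multiset (TypedTerm L V I), Multiset.Rel IsTyped F Γ ∧ ∃ d : Deriv L V I F,
    d.CutFree ∧ d.indices.Nodup ∧ d.eigenvars.Nodup ∧ (∀ a ∈ d.eigenvars, a ∉ X) ∧
      d.EigenLocal X

-- The rules for provability, and weakening

namespace Prov

variable {X : Set V} {Γ : Multiset (Prenex L V 0)}

theorem taut [Nonempty I] {Ps : Multiset (QFF L (V ⊕ Fin 0))} (h : ValidDisj Ps) :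
    Prov I X (Ps.map .qff) := by
  obtain ⟨i⟩ := ‹Nonempty I›
  refine ⟨_, ?_, .taut i Ps h, trivial, List.nodup_singleton i, List.nodup_nil,
    fun a ha => (List.not_mem_nil ha).elim, trivial⟩
  rw [Multiset.rel_map]
  exact Multiset.rel_refl_of_refl_on fun P _ => ⟨_, .leaf _ _ P, rfl⟩

/-- The conclusion lies outside the subderivation of the premise, so its free variables become
forbidden there; forbidding `a` as well keeps the eigenvariables distinct. -/
theorem allR {A : Prenex L V 1} {a : V} (ha : a ∉ X ∪ freeOf (.all A ::ₘ Γ))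
    (h : Prov I (insert a (X ∪ freeOf (.all A ::ₘ Γ))) (A.inst (.var a) ::ₘ Γ)) :
    Prov I X (.all A ::ₘ Γ) := by
  obtain ⟨F, hF, d, hc, hi, he, hX, hl⟩ := h
  obtain ⟨_, F, ⟨t, ht, rfl⟩, hF₁, rfl⟩ := Multiset.rel_cons_right.1 hF
  have hr : Multiset.Rel IsTyped (.tree (.alpha a t) (.all A) ::ₘ F) (.all A ::ₘ Γ) :=
    .cons ⟨_, .alpha a t A ht, rfl⟩ hF₁
  refine ⟨_, hr, .allR F a t A d, hc, hi, List.nodup_cons.2 ⟨fun h => hX a h (.inl rfl), he⟩, ?_, ?_⟩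
  · intro b hb
    rcases List.mem_cons.1 hb with rfl | hb
    · exact fun h => ha (.inl h)
    · exact fun h => hX b hb (.inr (.inl h))
  · simp only [Deriv.EigenLocal, freeType_eq_freeOf hr]
    exact ⟨ha, hl.anti (Set.subset_insert _ _)⟩

theorem exR {A : Prenex L V 1} (M : L.Term V)
    (h : Prov I (X ∪ freeOf (.ex A ::ₘ Γ)) (A.inst M ::ₘ Γ)) : Prov I X (.ex A ::ₘ Γ) := by
  obtain ⟨F, hF, d, hc, hi, he, hX, hl⟩ := h
  obtain ⟨_, F, ⟨t, ht, rfl⟩, hF₁, rfl⟩ := Multiset.rel_cons_right.1 hF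
  have hr : Multiset.Rel IsTyped (.tree (.sum (.eps M t)) (.ex A) ::ₘ F) (.ex A ::ₘ Γ) :=
    .cons ⟨_, .sum _ A (.eps M t A ht), rfl⟩ hF₁
  refine ⟨_, hr, .exR F M t A d, hc, hi, he, fun b hb h => hX b hb (.inl h), ?_⟩
  simpa only [Deriv.EigenLocal, freeType_eq_freeOf hr] using hl

theorem contrEx {A : Prenex L V 1}
    (h : Prov I (X ∪ freeOf (.ex A ::ₘ Γ)) (.ex A ::ₘ .ex A ::ₘ Γ)) :
    Prov I X (.ex A ::ₘ Γ) := by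
  obtain ⟨F, hF, d, hc, hi, he, hX, hl⟩ := h
  obtain ⟨_, F, ⟨t, ht, rfl⟩, hF₁, rfl⟩ := Multiset.rel_cons_right.1 hF
  obtain ⟨_, F, ⟨s, hs, rfl⟩, hF₂, rfl⟩ := Multiset.rel_cons_right.1 hF₁
  cases ht with | sum W _ hW => ?_
  cases hs with | sum W' _ hW' => ?_
  have hr : Multiset.Rel IsTyped (.tree (.sum (.add W W')) (.ex A) ::ₘ F) (.ex A ::ₘ Γ) :=
    .cons ⟨_, .sum _ A (.add W W' A hW hW'), rfl⟩ hF₂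
  refine ⟨_, hr, .contrEx F W W' A d, hc, hi, he, fun b hb h => hX b hb (.inl h), ?_⟩
  simpa only [Deriv.EigenLocal, freeType_eq_freeOf hr] using hl

/-- Weakening by an arbitrary formula, from weakening by quantifier-free formulas. -/
theorem weaken [Infinite V] (B : Prenex L V 0) (hX : X.Finite)
    (h : ∀ (Y : Set V) (P : QFF L (V ⊕ Fin 0)), Y.Finite → Prov I Y (.qff P ::ₘ Γ)) :
    Prov I X (B ::ₘ Γ) := by
  induction B using Prenex.inst_induction generalizing X with
  | qff P => exact h X P hX
  | all A ih =>
    have hf := hX.union (freeOf_finite (.all A ::ₘ Γ))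
    obtain ⟨a, ha⟩ := hf.exists_notMem
    exact allR ha (ih _ (hf.insert a))
  | ex A ih =>
    obtain ⟨a⟩ : Nonempty V := inferInstance
    -- A witness need not be fresh, so any variable serves.
    exact exR (.var a) (ih _ (hX.union (freeOf_finite _)))

/-- A tautology absorbs any further quantifier-free disjuncts. Quantified members of `Γ` are reduced
to such disjuncts by `weaken`; `Ps` accumulates what goes into the axiom. -/
theorem of_valid [Infinite V] [Nonempty I] (Ps : Multiset (QFF L (V ⊕ Fin 0))) (hX : X.Finite)
    (h : ∀ (M : Type (max u w)) [L.Structure M] [Nonempty M] (s : V → M),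
      ∃ P, (P ∈ Ps ∨ .qff P ∈ Γ) ∧ P.Realize (Sum.elim s Fin.elim0)) :
    Prov I X (Ps.map .qff + Γ) := by
  induction Γ using Multiset.induction_on generalizing Ps X with
  | empty => simpa using taut (I := I) (X := X) (Ps := Ps) (fun M _ _ s => by simpa using h M s)
  | cons B Γ ih =>
    cases B with
    | qff P =>
      have := ih (P ::ₘ Ps) hX fun M _ _ s => by
        obtain ⟨Q, hQ, hr⟩ := h M s
        refine ⟨Q, ?_, hr⟩
        simp only [Multiset.mem_cons, Prenex.qff.injEq] at hQ ⊢
        tauto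
      simpa [Multiset.add_cons, Multiset.cons_add] using this
    | _ =>
      rw [Multiset.add_cons]
      refine weaken _ hX fun Y P hY => ?_
      have := ih (P ::ₘ Ps) hY fun M _ _ s => by
        obtain ⟨Q, hQ, hr⟩ := h M s
        refine ⟨Q, ?_, hr⟩
        simp only [Multiset.mem_cons, reduceCtorEq, false_or] at hQ ⊢
        tauto
      simpa [Multiset.cons_add] using this

end Prov

/-! ### Term models -/

/-- The structure on terms in which `v` says which atoms are true. -/
@[reducible]
def termStructure (v : ∀ n, L.Relations n → (Fin n → L.Term V) → Prop) :
    L.Structure (L.Term V) where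
  funMap := fun f ts => .func f ts
  RelMap := fun {n} p ts => v n p ts

theorem realize_termStructure (v : ∀ n, L.Relations n → (Fin n → L.Term V) → Prop)
    {α : Type*} (σ : α → L.Term V) (t : L.Term α) :
    letI := termStructure v
    t.realize σ = t.subst σ := by
  induction t with
  | var a => rfl
  | func f ts ih => exact congrArg (Term.func f) (funext ih)

theorem term_subst_var {α : Type*} (t : L.Term α) : t.subst Term.var = t := by
  induction t with
  | var a => rfl
  | func f ts ih => exact congrArg (Term.func f) (funext ih)

/-- Truth of a quantifier-free formula with terms substituted for its variables, when `v` says which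
atoms are true. -/
abbrev AtomRealize (v : ∀ n, L.Relations n → (Fin n → L.Term V) → Prop)
    {α : Type*} (σ : α → L.Term V) (P : QFF L α) : Prop :=
  @QFF.Realize L α (L.Term V) (termStructure v) σ P

/-- Evaluating terms in a structure transfers its atomic truths to the terms, so valuations on terms
suffice to test quantifier-free validity. -/
theorem atomRealize_pullback {M α : Type*} [L.Structure M] (s : V → M) (σ : α → L.Term V)
    (P : QFF L α) :
    AtomRealize (fun _ p ts => Structure.RelMap p fun i => (ts i).realize s) σ P ↔
      P.Realize fun a => (σ a).realize s := by
  induction P with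
  | lit pos p N =>
    cases pos <;> simp [AtomRealize, QFF.Realize, realize_termStructure, Structure.RelMap,
      Term.realize_subst]
  | and P Q hP hQ => exact and_congr hP hQ
  | or P Q hP hQ => exact or_congr hP hQ

/-- The quantifier-free case of Łoś's theorem, with the universe of terms held fixed: an ultrafilter
commutes with negation, conjunction and disjunction. -/
theorem atomRealize_ultrafilter {ι α : Type*} (U : Ultrafilter ι)
    (v : ι → ∀ n, L.Relations n → (Fin n → L.Term V) → Prop) (σ : α → L.Term V) (P : QFF L α) :
    AtomRealize (fun n p ts => ∀ᶠ k in U, v k n p ts) σ P ↔ ∀ᶠ k in U, AtomRealize (v k) σ P := by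
  induction P with
  | lit pos p N =>
    cases pos
    · simp only [AtomRealize, QFF.Realize, realize_termStructure, Structure.RelMap]
      exact Ultrafilter.eventually_not.symm
    · simp only [AtomRealize, QFF.Realize, realize_termStructure, Structure.RelMap]
  | and P Q hP hQ => exact (and_congr hP hQ).trans eventually_and.symm
  | or P Q hP hQ => exact (or_congr hP hQ).trans Ultrafilter.eventually_or.symm

/-! ### The refutation branch -/

/-- `C` is listed in `Γ`, up to instantiation of leading universal quantifiers by variables. -/
inductive Handled (Γ : Multiset (Prenex L V 0)) : Prenex L V 0 → Prop
  | qff (P : QFF L (V ⊕ Fin 0)) : .qff P ∈ Γ → Handled Γ (.qff P)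
  | ex (A : Prenex L V 1) : .ex A ∈ Γ → Handled Γ (.ex A)
  | all (A : Prenex L V 1) (a : V) : Handled Γ (A.inst (.var a)) → Handled Γ (.all A)

theorem Handled.mono {Γ Δ : Multiset (Prenex L V 0)} {C : Prenex L V 0} (h : Handled Γ C)
    (hΓ : Γ ⊆ Δ) : Handled Δ C := by
  induction h with
  | qff P h => exact .qff P (hΓ h)
  | ex A h => exact .ex A (hΓ h)
  | all A a _ ih => exact .all A a ih

/-- This is `Prov.allR` read upwards. The universal formula itself may be dropped, since refuting a
single instance refutes it. -/
theorem exists_handled [Infinite V] {X : Set V} {Γ : Multiset (Prenex L V 0)} {B : Prenex L V 0}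
    (hX : X.Finite) (h : ¬ Prov I X (B ::ₘ Γ)) :
    ∃ (Y : Set V) (Δ : Multiset (Prenex L V 0)), Y.Finite ∧ ¬ Prov I Y Δ ∧ Γ ⊆ Δ ∧ Handled Δ B := by
  induction B using Prenex.inst_induction generalizing X with
  | qff P => exact ⟨X, _, hX, h, Multiset.subset_cons _ _, .qff P (Multiset.mem_cons_self _ _)⟩
  | all A ih =>
    have hf := hX.union (freeOf_finite (.all A ::ₘ Γ))
    obtain ⟨a, ha⟩ := hf.exists_notMem
    obtain ⟨Y, Δ, hY, hp, hs, hh⟩ := ih (.var a) (hf.insert a) fun hp => h (.allR ha hp)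
    exact ⟨Y, Δ, hY, hp, hs, .all A a hh⟩
  | ex A ih => exact ⟨X, _, hX, h, Multiset.subset_cons _ _, .ex A (Multiset.mem_cons_self _ _)⟩

/-- Unprovable multisets of formulas, with a finite set of forbidden eigenvariables. -/
structure Unprovable (L : FirstOrder.Language.{u, v}) (V : Type w) (I : Type x) where
  /-- the forbidden eigenvariables -/
  forbidden : Set V
  /-- the formulas -/
  formulas : Multiset (Prenex L V 0)
  finite_forbidden : forbidden.Finite
  not_prov : ¬ Prov I forbidden formulas

-- Saturation of unprovable multisets

namespace Unprovable

theorem exists_instance [Infinite V] (S : Unprovable L V I) {A : Prenex L V 1}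
    (hA : .ex A ∈ S.formulas) (M : L.Term V) :
    ∃ S' : Unprovable L V I, S.formulas ⊆ S'.formulas ∧ Handled S'.formulas (A.inst M) := by
  obtain ⟨X, Γ, hX, hp⟩ := S
  obtain ⟨Γ, rfl⟩ := Multiset.exists_cons_of_mem hA
  have hf := hX.union (freeOf_finite (.ex A ::ₘ Γ))
  obtain ⟨Y, Δ, hY, hq, hs, hh⟩ := exists_handled (B := A.inst M) (Γ := .ex A ::ₘ Γ)
    (hf.union (freeOf_finite (.ex A ::ₘ .ex A ::ₘ Γ)))
    -- One copy of the existential formula is instantiated; the other survives for later terms.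
    fun h => hp (.contrEx (.exR M h))
  exact ⟨⟨Y, Δ, hY, hq⟩, hs, hh⟩

theorem exists_instances [Infinite V] (S : Unprovable L V I)
    (l : List (Prenex L V 0 × L.Term V)) :
    ∃ S' : Unprovable L V I, S.formulas ⊆ S'.formulas ∧ ∀ p ∈ l, p.1 ∈ S.formulas →
      ∀ A, p.1 = .ex A → Handled S'.formulas (A.inst p.2) := by
  induction l with
  | nil => exact ⟨S, Multiset.Subset.refl _, by simp⟩
  | cons p l ih =>
    obtain ⟨S₁, hs, hl⟩ := ih
    by_cases hp : ∃ A, p.1 = .ex A ∧ p.1 ∈ S.formulas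
    · obtain ⟨A, hA, hm⟩ := hp
      obtain ⟨S₂, hs₂, hh⟩ := S₁.exists_instance (hA ▸ hs hm) p.2
      refine ⟨S₂, fun C hC => hs₂ (hs hC), fun q hq hm B hB => ?_⟩
      rcases List.mem_cons.1 hq with rfl | hq
      · cases hA.symm.trans hB
        exact hh
      · exact (hl q hq hm B hB).mono hs₂
    · refine ⟨S₁, hs, fun q hq hm B hB => ?_⟩
      rcases List.mem_cons.1 hq with rfl | hq
      · exact (hp ⟨B, hB, hm⟩).elim
      · exact hl q hq hm B hB

theorem exists_atomRealize [Infinite V] [Nonempty I] (S : Unprovable L V I) :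
    ∃ v : ∀ n, L.Relations n → (Fin n → L.Term V) → Prop, ∀ P, .qff P ∈ S.formulas →
      ¬ AtomRealize v (Sum.elim Term.var Fin.elim0) P := by
  by_contra! hv
  refine S.not_prov ?_
  rw [← zero_add S.formulas]
  refine Prov.of_valid 0 S.finite_forbidden fun M _ _ s => ?_
  obtain ⟨P, hP, hr⟩ := hv fun _ p ts => Structure.RelMap p fun i => (ts i).realize s
  refine ⟨P, .inr hP, ?_⟩
  rw [atomRealize_pullback] at hr
  convert hr using 2 with a
  rcases a with a | i
  · rfl
  · exact i.elim0

/-- A sequence of unprovable multisets in which every existential formula is eventually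
instantiated by every term. -/
theorem exists_saturated [Countable L.Symbols] [Countable V] [Infinite V]
    (S : Unprovable L V I) :
    ∃ T : ℕ → Unprovable L V I, T 0 = S ∧ (Monotone fun n => {A | A ∈ (T n).formulas}) ∧
      ∀ n A M, .ex A ∈ (T n).formulas → ∃ m, Handled (T m).formulas (A.inst M) := by
  have : Countable (Σ n, L.Functions n) :=
    (Sum.inl_injective (α := Σ n, L.Functions n) (β := Σ n, L.Relations n)).countable
  have : Nonempty (L.Term V) := ⟨.var (Classical.arbitrary V)⟩
  obtain ⟨e, he⟩ := exists_surjective_nat (L.Term V)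
  -- Stage `n` pairs all current formulas with the first `n` terms, a finite task.
  choose next hsub hnext using fun (S : Unprovable L V I) (n : ℕ) =>
    S.exists_instances (S.formulas.toList ×ˢ (List.range n).map e)
  let T : ℕ → Unprovable L V I := fun n => Nat.rec S (fun n S => next S n) n
  have hmono : Monotone fun n => {A | A ∈ (T n).formulas} :=
    monotone_nat_of_le_succ fun n A hA => hsub (T n) n hA
  refine ⟨T, rfl, hmono, fun n A M hA => ?_⟩
  obtain ⟨k, rfl⟩ := he M
  -- By stage `m` the formula is present and `e k` is among the first `m` terms.
  let m := max n (k + 1)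
  have hm : .ex A ∈ (T m).formulas := hmono (le_max_left n (k + 1)) hA
  refine ⟨m + 1, hnext (T m) m (.ex A, e k) ?_ hm A rfl⟩
  refine List.mem_product.2 ⟨Multiset.mem_toList.2 hm, List.mem_map_of_mem ?_⟩
  exact List.mem_range.2 (le_max_right n (k + 1))

end Unprovable

-- The limit countermodel

theorem prov_of_valid [Countable L.Symbols] [Countable V] [Infinite V] [Nonempty I]
    {A : Prenex L V 0} (hA : A.Valid) : Prov I ∅ {A} := by
  by_contra h
  obtain ⟨X, Γ, hX, hp, -, hh⟩ := exists_handled (I := I) (Γ := 0) Set.finite_empty h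
  obtain ⟨T, hT, hmono, hinst⟩ := (Unprovable.mk X Γ hX hp).exists_saturated
  choose v hv using fun n => (T n).exists_atomRealize
  let U : Ultrafilter ℕ := hyperfilter ℕ
  let := termStructure (V := V) fun n p ts => ∀ᶠ k in U, v k n p ts
  have hvar (N : L.Term V) : N.realize Term.var = N :=
    (realize_termStructure _ _ N).trans (term_subst_var N)
  -- The stage `n` is quantified inside the induction because an instance of an existential formula
  -- may be handled only at a later stage.
  have key (C : Prenex L V 0) : ∀ n, Handled (T n).formulas C →
      ¬ C.Realize (Term.var : V → L.Term V) Fin.elim0 := by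
    induction C using Prenex.inst_induction with
    | qff P =>
      intro n hP hr
      cases hP with | qff _ hP => ?_
      have hev := (atomRealize_ultrafilter U v _ P).1 hr
      -- Nonprincipality gives a stage `k ≥ n` whose valuation makes `P` true, although `P` persists
      -- to that stage and is falsified there.
      have hge : ∀ᶠ k in U, n ≤ k :=
        (Nat.hyperfilter_le_atTop : (U : Filter ℕ) ≤ atTop) (eventually_ge_atTop n)
      obtain ⟨k, hk, hnk⟩ := (hev.and hge).exists
      exact hv k P (hmono hnk hP) hk
    | all A ih =>
      intro n hh hr
      cases hh with | all _ a hh => ?_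
      exact ih _ n hh ((Prenex.realize_inst_zero _ _ A).2 (hr _))
    | ex A ih =>
      rintro n hh ⟨M, hr⟩
      cases hh with | ex _ hm => ?_
      obtain ⟨m, hh⟩ := hinst n A M hm
      refine ih M m hh ((Prenex.realize_inst_zero _ _ A).2 ?_)
      rwa [hvar]
  have : Nonempty (L.Term V) := ⟨.var (Classical.arbitrary V)⟩
  exact key A 0 (by rwa [hT]) (hA (L.Term V) Term.var)

end LKH

theorem mainTheorem4 (L : FirstOrder.Language.{u, v}) [Countable L.Symbols]
    [Nonempty L.Constants]
    (V : Type w) [Countable V] [Infinite V] (I : Type x) [Countable I] [Nonempty I]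
    (A : LKH.Prenex L V 0) (hclosed : A.free = ∅) (hvalid : A.Valid) :
    ∃ t : LKH.ExpTree L V I, t.HasType A ∧
      ∃ Φ : LKH.Deriv L V I {LKH.TypedTerm.tree t A}, Φ.CutFree ∧ Φ.Strict := by
  obtain ⟨F, hF, d, hc, hi, he, -, hl⟩ := LKH.prov_of_valid (I := I) hvalid
  obtain ⟨_, F, ⟨t, ht, rfl⟩, hF₁, rfl⟩ := Multiset.rel_cons_right.1 hF
  obtain rfl := Multiset.rel_zero_right.1 hF₁
  exact ⟨t, ht, d, hc, hi, he, hl⟩
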